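/- **Theorem 4.7.** For a Boolean algebra $\mathfrak A$ and a real $r>0$ let $M_r(\mathfrak A)$ be the set of finitely additive functions $\mu:\mathfrak A\to\mathbb R$ with $\|\mu\|\le r$, where $\|\mu\|$ is the supremum of $\sum_{a\in P}|\mu(a)|$ over all finite partitions $P$ of the unit of $\mathfrak A$. Let $M^{\mathbb Q}_r(\mathfrak A)$ be the set of those $\mu\in M_r(\mathfrak A)$ having only rational values. For a subalgebra $\mathfrak B$ of $\mathfrak A$ put $\operatorname{dist}_{\mathfrak B}(\varphi,\psi)=\sup_{b\in\mathfrak B}|\varphi(b)-\psi(b)|$. * $\mathfrak A$ has $\mathrm{LEP}(r)$ if there is a family $\mathbb B$ of finite subalgebras of $\mathfrak A$ such that (i) every finite subalgebra of $\mathfrak A$ is contained in some member of $\mathbb B$; (ii) every uncountable $\mathbb B'\subseteq\mathbb B$ contains two distinct members $\mathfrak B_1,\mathfrak B_2$ such that any $\nu_1\in M^{\mathbb Q}_1(\mathfrak B_1)$ and $\nu_2\in M^{\mathbb Q}_1(\mathfrak B_2)$ that agree on $\mathfrak B_1\cap\mathfrak B_2$ have a common extension $\nu\in M^{\mathbb Q}_r(\langle\mathfrak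 B_1\cup\mathfrak B_2\rangle)$, where $\langle\mathfrak B_1\cup\mathfrak B_2\rangle$ is the subalgebra generated by $\mathfrak B_1\cup\mathfrak B_2$. * $\mathfrak A$ has the approximation property if for every sequence of functions $\varphi_n:\mathfrak A\to[-1,1]$ such that $$\inf_{\mu\in M_1(\mathfrak A)}\operatorname{dist}_{\mathfrak B}(\mu,\varphi_n)\xrightarrow[n\to\infty]{}0\quad\text{for every finite subalgebra }\mathfrak B\subseteq\mathfrak A,$$ there are $R>0$ and $\nu_n\in M_R(\mathfrak A)$, $n\in\mathbb N$, such that $\varphi_n(a)-\nu_n(a)\to0$ for every $a\in\mathfrak A$. * $\mathrm{MA}(\kappa)$ is the statement: for every nonempty partially ordered set $P$ in which every uncountable subset contains two distinct elements with a common upper bound in $P$, and every family $(D_\xi)_{\xi<\kappa}$ of subsets of $P$ that are dense (for every $p\in P$ there is $d\in D_\xi$ with $p\le d$), there is an upwards directed set $G\subseteq P$ with $G\cap D_\xi\ne\emptyset$ for all $\xi<\kappa$. Let $\mathfrak A$ be a Boolean algebra with $|\mathfrak A|=\kappa$. Suppose that $\mathfrak A$ has $\mathrm{LEP}(r)$ for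 some $r>1$ and that the Stone space of $\mathfrak A$ (the space of ultrafilters on $\mathfrak A$) is separable. If $\mathrm{MA}(\kappa)$ holds, then $\mathfrak A$ has the approximation property. -/

import Mathlib

open Set Filter Topology Cardinal

universe u

/-! ### Finitely additive signed measures on a Boolean algebra -/

/-- A real-valued set function on a Boolean algebra is finitely additive. -/
def IsFinAdditive {A : Type u} [BooleanAlgebra A] (μ : A → ℝ) : Prop :=
  ∀ a b : A, Disjoint a b → μ (a ⊔ b) = μ a + μ b

/-- The norm `‖μ‖ = |μ|(⊤)`: the supremum of `∑ |μ a|` over all finite partitions of the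
unit element. -/
noncomputable def measureNorm {A : Type u} [BooleanAlgebra A] (μ : A → ℝ) : ENNReal :=
  ⨆ P : Finpartition (⊤ : A), ∑ a ∈ P.parts, ENNReal.ofReal |μ a|

/-- `M_r(A)`: the finitely additive signed measures on `A` of norm at most `r`. -/
def measureBall (A : Type u) [BooleanAlgebra A] (r : ℝ) : Set (A → ℝ) :=
  {μ | IsFinAdditive μ ∧ measureNorm μ ≤ ENNReal.ofReal r}

/-- The members of `M_r(A)` all of whose values are rational. -/
def ratMeasureBall (A : Type u) [BooleanAlgebra A] (r : ℝ) : Set (A → ℝ) :=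
  {μ | μ ∈ measureBall A r ∧ ∀ a, ∃ q : ℚ, μ a = (q : ℝ)}

/-! ### The approximation property -/

/-- `dist_B(φ, ψ) = sup_{b ∈ B} |φ b - ψ b|`, used for finite subalgebras `B` only, so that the
supremum is a maximum. -/
noncomputable def distOn {A : Type u} [BooleanAlgebra A] (B : BooleanSubalgebra A)
    (φ ψ : A → ℝ) : ℝ :=
  ⨆ b : B, |φ b - ψ b|

/-- The sequence `φ` is asymptotically a measure of norm at most `1` on every finite
subalgebra. -/
def AsympMeasure {A : Type u} [BooleanAlgebra A] (φ : ℕ → A → ℝ) : Prop :=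
  ∀ B : BooleanSubalgebra A, (B : Set A).Finite →
    Tendsto (fun n => ⨅ μ : measureBall A 1, distOn B (μ : A → ℝ) (φ n)) atTop (𝓝 0)

/-- The approximation property of a Boolean algebra. -/
def ApproximationProperty (A : Type u) [BooleanAlgebra A] : Prop :=
  ∀ φ : ℕ → A → ℝ, (∀ n a, φ n a ∈ Icc (-1 : ℝ) 1) → AsympMeasure φ →
    ∃ ν : ℕ → A → ℝ, (∃ R : ℝ, ∀ n, ν n ∈ measureBall A R) ∧
      ∀ a, Tendsto (fun n => φ n a - ν n a) atTop (𝓝 0)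

/-! ### The local extension property -/

/-- Two functions defined on subalgebras agree on the intersection of the subalgebras. -/
def Consistent {A : Type u} [BooleanAlgebra A] {B₁ B₂ : BooleanSubalgebra A}
    (ν₁ : B₁ → ℝ) (ν₂ : B₂ → ℝ) : Prop :=
  ∀ (a : A) (h₁ : a ∈ B₁) (h₂ : a ∈ B₂), ν₁ ⟨a, h₁⟩ = ν₂ ⟨a, h₂⟩

/-- `ν`, defined on the larger algebra `C`, extends `μ`, defined on the smaller one `B`. -/
def Extends {A : Type u} [BooleanAlgebra A] {B C : BooleanSubalgebra A}
    (ν : C → ℝ) (μ : B → ℝ) : Prop :=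
  ∀ (a : A) (hB : a ∈ B), ∃ hC : a ∈ C, ν ⟨a, hC⟩ = μ ⟨a, hB⟩

/-- The local extension property with constant `r`. The algebra generated by `B₁ ∪ B₂`
is the join `B₁ ⊔ B₂` in the lattice of subalgebras. -/
def LEP (A : Type u) [BooleanAlgebra A] (r : ℝ) : Prop :=
  ∃ 𝓑 : Set (BooleanSubalgebra A),
    (∀ B ∈ 𝓑, (B : Set A).Finite) ∧
    (∀ C : BooleanSubalgebra A, (C : Set A).Finite → ∃ B ∈ 𝓑, C ≤ B) ∧
    ∀ 𝓑' : Set (BooleanSubalgebra A), 𝓑' ⊆ 𝓑 → ¬ 𝓑'.Countable →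
      ∃ B₁ ∈ 𝓑', ∃ B₂ ∈ 𝓑', B₁ ≠ B₂ ∧
        ∀ ν₁ ∈ ratMeasureBall B₁ 1, ∀ ν₂ ∈ ratMeasureBall B₂ 1, Consistent ν₁ ν₂ →
          ∃ ν ∈ ratMeasureBall (B₁ ⊔ B₂ : BooleanSubalgebra A) r,
            Extends ν ν₁ ∧ Extends ν ν₂

/-! ### The Stone space -/

/-- `Ult(A)`: the ultrafilters on a Boolean algebra `A`. -/
@[ext]
structure Ult (A : Type u) [BooleanAlgebra A] where
  /-- The elements of the ultrafilter. -/
  carrier : Set A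
  top_mem : ⊤ ∈ carrier
  bot_notMem : ⊥ ∉ carrier
  mem_of_le : ∀ a b, a ∈ carrier → a ≤ b → b ∈ carrier
  inf_mem : ∀ a b, a ∈ carrier → b ∈ carrier → a ⊓ b ∈ carrier
  mem_or_compl_mem : ∀ a, a ∈ carrier ∨ aᶜ ∈ carrier

/-- The Stone topology, generated by the sets `{x | a ∈ x}` for `a` in `A`. -/
instance Ult.instTopologicalSpace (A : Type u) [BooleanAlgebra A] : TopologicalSpace (Ult A) :=
  TopologicalSpace.generateFrom (Set.range fun a : A => {x : Ult A | a ∈ x.carrier})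

/-! ### Martin's axiom -/

/-- The countable chain condition, upwards: every uncountable set contains two distinct
conditions with a common upper bound. -/
def CCC (P : Type u) [PartialOrder P] : Prop :=
  ∀ S : Set P, ¬ S.Countable → ∃ p ∈ S, ∃ q ∈ S, p ≠ q ∧ ∃ r, p ≤ r ∧ q ≤ r

/-- Upwards density in a partially ordered set. -/
def PosetDense {P : Type u} [PartialOrder P] (D : Set P) : Prop :=
  ∀ p, ∃ d ∈ D, p ≤ d

/-- Martin's axiom `MA(κ)`. As always in this axiom, the partial orders are nonempty. -/
def MartinAxiom (κ : Cardinal.{u}) : Prop :=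
  ∀ (P : Type u) [PartialOrder P] [Nonempty P], CCC P →
    ∀ (ι : Type u), #ι = κ → ∀ D : ι → Set P, (∀ i, PosetDense (D i)) →
      ∃ G : Set P, DirectedOn (· ≤ ·) G ∧ ∀ i, (G ∩ D i).Nonempty

/-! The measures are produced by a ccc forcing with finite approximations. Separability gives
countably many ultrafilters meeting every nonzero element, so each rational measure on a finite
subalgebra is induced, with the same norm, by a finite rational combination of Dirac measures from
this countable set (`exists_atomicMeasure_eq`). A condition is a finite list of such combinations of
norm at most `r`, a subalgebra in `𝓑`, a precision, and the promise that every later `φ m` is close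
on that subalgebra to a rational measure of norm at most 1. A stronger condition appends measures
close to `φ` on the old subalgebra.

The chain condition (`Approximation.ccc`) is where LEP enters. Among uncountably many conditions,
uncountably many share list, precision and size of the subalgebra. For two of these, the promised
measures nearly agree on the intersection. A small perturbation makes them agree exactly
(`exists_consistent_near`), and LEP extends them jointly with norm at most `r`. Such appending is
needed only for finitely many indices, until `AsympMeasure` supplies a promise on a subalgebra
containing both. A directed set meeting the dense sets of `Approximation.exists_ge` then yields the
sequence. -/

/-! ### Finite Boolean algebras and subalgebras -/

/-- The subalgebra generated by a finite set is finite. -/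
theorem BooleanSubalgebra.finite_closure {A : Type u} [BooleanAlgebra A] {s : Set A}
    (hs : s.Finite) : (BooleanSubalgebra.closure s : Set A).Finite := by
  set t : Set A := s ∪ compl '' s ∪ {⊥, ⊤} with ht
  have htc : ∀ a ∈ t, aᶜ ∈ t := by
    rintro a ((ha | ⟨b, hb, rfl⟩) | rfl | rfl)
    · exact Or.inl (Or.inr ⟨a, ha, rfl⟩)
    · exact Or.inl (Or.inl (by simpa using hb))
    · exact Or.inr (by simp)
    · exact Or.inr (by simp)
  have htf : t.Finite := (hs.union (hs.image _)).union (by simp)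
  -- Since `t` is closed under complements, so is its lattice closure, by De Morgan.
  let L : BooleanSubalgebra A :=
    { carrier := latticeClosure t
      supClosed' := isSublattice_latticeClosure.1
      infClosed' := isSublattice_latticeClosure.2
      bot_mem' := subset_latticeClosure (by simp [ht])
      compl_mem' := by
        intro a ha
        induction ha using latticeClosure_sup_inf_induction with
        | mem a ha => exact subset_latticeClosure (htc a ha)
        | sup a ha b hb iha ihb =>
          rw [compl_sup]; exact isSublattice_latticeClosure.2 iha ihb
        | inf a ha b hb iha ihb =>
          rw [compl_inf]; exact isSublattice_latticeClosure.1 iha ihb }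
  have hle : BooleanSubalgebra.closure s ≤ L :=
    BooleanSubalgebra.closure_le.2 fun a ha => subset_latticeClosure (Or.inl (Or.inl ha))
  exact htf.latticeClosure.subset hle

theorem BooleanSubalgebra.finite_sup {A : Type u} [BooleanAlgebra A] {B C : BooleanSubalgebra A}
    (hB : (B : Set A).Finite) (hC : (C : Set A).Finite) :
    ((B ⊔ C : BooleanSubalgebra A) : Set A).Finite := by
  refine (BooleanSubalgebra.finite_closure (hB.union hC)).subset ?_
  exact (sup_le (fun a ha => BooleanSubalgebra.subset_closure (Or.inl ha))
    (fun a ha => BooleanSubalgebra.subset_closure (Or.inr ha)) : B ⊔ C ≤ _)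

/-- The atoms of a finite Boolean algebra. -/
noncomputable def atomFinset (C : Type u) [BooleanAlgebra C] [Finite C] : Finset C :=
  (Set.toFinite {a : C | IsAtom a}).toFinset

theorem mem_atomFinset {C : Type u} [BooleanAlgebra C] [Finite C] {a : C} :
    a ∈ atomFinset C ↔ IsAtom a := by
  simp [atomFinset]

open Classical in
theorem sup_atomFinset_filter {C : Type u} [BooleanAlgebra C] [Finite C] (b : C) :
    ((atomFinset C).filter (· ≤ b)).sup id = b := by
  apply le_antisymm
  · exact Finset.sup_le fun a ha => (Finset.mem_filter.1 ha).2
  · refine BooleanAlgebra.le_iff_atom_le_imp.2 fun a ha hab => ?_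
    exact Finset.le_sup (f := id) (Finset.mem_filter.2 ⟨mem_atomFinset.2 ha, hab⟩)

theorem pairwiseDisjoint_atomFinset (C : Type u) [BooleanAlgebra C] [Finite C] :
    (atomFinset C : Set C).PairwiseDisjoint id := fun _ ha _ hb hab =>
  (mem_atomFinset.1 ha).disjoint_of_ne (mem_atomFinset.1 hb) hab

/-- The partition of the unit of a finite Boolean algebra into atoms. -/
noncomputable def atomPartition (C : Type u) [BooleanAlgebra C] [Finite C] :
    Finpartition (⊤ : C) where
  parts := atomFinset C
  supIndep := Finset.supIndep_iff_pairwiseDisjoint.2 (pairwiseDisjoint_atomFinset C)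
  sup_parts := by
    classical
    simpa using sup_atomFinset_filter (⊤ : C)
  bot_notMem := fun h => (mem_atomFinset.1 h).1 rfl

/-! ### Finitely additive functions -/

theorem IsFinAdditive.map_bot {A : Type u} [BooleanAlgebra A] {μ : A → ℝ}
    (hμ : IsFinAdditive μ) : μ ⊥ = 0 := by
  have := hμ ⊥ ⊥ disjoint_bot_left
  simp at this
  exact this

theorem IsFinAdditive.map_finset_sup {A : Type u} [BooleanAlgebra A] {μ : A → ℝ}
    (hμ : IsFinAdditive μ) (s : Finset A) (hs : (s : Set A).PairwiseDisjoint id) :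
    μ (s.sup id) = ∑ a ∈ s, μ a := by
  classical
  induction s using Finset.induction_on with
  | empty => simpa using hμ.map_bot
  | insert a s ha ih =>
    rw [Finset.sup_insert, Finset.sum_insert ha, hμ, ih]
    · rfl
    · exact hs.subset (by simp)
    · rw [Finset.disjoint_sup_right]
      intro b hb
      exact hs (by simp) (by simp [hb]) (by rintro rfl; exact ha hb)

open Classical in
theorem IsFinAdditive.eq_sum_atoms {C : Type u} [BooleanAlgebra C] [Finite C] {μ : C → ℝ}
    (hμ : IsFinAdditive μ) (b : C) :
    μ b = ∑ a ∈ atomFinset C, if a ≤ b then μ a else 0 := by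
  rw [← Finset.sum_filter, ← hμ.map_finset_sup _ ((pairwiseDisjoint_atomFinset C).subset
    fun _ ha => (Finset.mem_filter.1 ha).1),
    sup_atomFinset_filter]

theorem mem_measureBall_iff {A : Type u} [BooleanAlgebra A] {μ : A → ℝ} {s : ℝ} (hs : 0 ≤ s) :
    μ ∈ measureBall A s ↔
      IsFinAdditive μ ∧ ∀ P : Finpartition (⊤ : A), ∑ a ∈ P.parts, |μ a| ≤ s := by
  simp only [measureBall, Set.mem_ofPred_eq, measureNorm, iSup_le_iff]
  refine and_congr Iff.rfl (forall_congr' fun P => ?_)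
  rw [← ENNReal.ofReal_sum_of_nonneg fun _ _ => abs_nonneg _, ENNReal.ofReal_le_ofReal_iff hs]

theorem measureBall_sum_atoms_le {C : Type u} [BooleanAlgebra C] [Finite C] {μ : C → ℝ} {s : ℝ}
    (hs : 0 ≤ s) (hμ : μ ∈ measureBall C s) : ∑ a ∈ atomFinset C, |μ a| ≤ s :=
  ((mem_measureBall_iff hs).1 hμ).2 (atomPartition C)

theorem measureBall_abs_le {C : Type u} [BooleanAlgebra C] [Finite C] {μ : C → ℝ} {s : ℝ}
    (hs : 0 ≤ s) (hμ : μ ∈ measureBall C s) (b : C) : |μ b| ≤ s := by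
  classical
  refine le_trans ?_ (measureBall_sum_atoms_le hs hμ)
  rw [hμ.1.eq_sum_atoms b]
  refine (Finset.abs_sum_le_sum_abs _ _).trans (Finset.sum_le_sum fun a _ => ?_)
  split_ifs <;> simp

theorem measureBall_add {A : Type u} [BooleanAlgebra A] {μ ν : A → ℝ} {s t : ℝ}
    (hs : 0 ≤ s) (ht : 0 ≤ t) (hμ : μ ∈ measureBall A s) (hν : ν ∈ measureBall A t) :
    (fun a => μ a + ν a) ∈ measureBall A (s + t) := by
  rw [mem_measureBall_iff (by positivity)]
  rw [mem_measureBall_iff hs] at hμ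
  rw [mem_measureBall_iff ht] at hν
  refine ⟨fun a b h => ?_, fun P => ?_⟩
  · simp only [hμ.1 a b h, hν.1 a b h]; ring
  · refine le_trans (Finset.sum_le_sum fun a _ => abs_add_le _ _) ?_
    rw [Finset.sum_add_distrib]
    exact add_le_add (hμ.2 P) (hν.2 P)

theorem measureBall_smul {A : Type u} [BooleanAlgebra A] {μ : A → ℝ} {s t : ℝ}
    (hs : 0 ≤ s) (ht : 0 ≤ t) (hμ : μ ∈ measureBall A s) :
    (fun a => t * μ a) ∈ measureBall A (t * s) := by
  rw [mem_measureBall_iff (by positivity)]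
  rw [mem_measureBall_iff hs] at hμ
  refine ⟨fun a b h => ?_, fun P => ?_⟩
  · simp only [hμ.1 a b h]; ring
  · simp only [abs_mul, abs_of_nonneg ht, ← Finset.mul_sum]
    exact mul_le_mul_of_nonneg_left (hμ.2 P) ht

theorem measureBall_mono {A : Type u} [BooleanAlgebra A] {s t : ℝ} (h : s ≤ t) :
    measureBall A s ⊆ measureBall A t := fun _ hμ =>
  ⟨hμ.1, hμ.2.trans (ENNReal.ofReal_le_ofReal h)⟩

/-- A partition of the unit in a subalgebra is a partition of the unit in the algebra. -/
def Finpartition.ofSubalgebra {A : Type u} [BooleanAlgebra A] {B : BooleanSubalgebra A}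
    (P : Finpartition (⊤ : B)) : Finpartition (⊤ : A) where
  parts := P.parts.map ⟨Subtype.val, Subtype.val_injective⟩
  supIndep := by
    rw [Finset.supIndep_iff_pairwiseDisjoint]
    simp only [Finset.coe_map, Function.Embedding.coeFn_mk]
    rintro _ ⟨a, ha, rfl⟩ _ ⟨b, hb, rfl⟩ hab
    have := P.disjoint ha hb (by rintro rfl; exact hab rfl)
    simp only [Function.onFun, id, disjoint_iff] at this ⊢
    exact congrArg Subtype.val this
  sup_parts := by
    have h := congrArg B.subtype P.sup_parts
    rw [map_finset_sup] at h
    rw [Finset.sup_map]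
    exact h
  bot_notMem := by
    simp only [Finset.mem_map, Function.Embedding.coeFn_mk, not_exists, not_and]
    intro a ha h
    exact P.bot_notMem (by convert ha; exact Subtype.ext h.symm)

theorem measureBall_restrict {A : Type u} [BooleanAlgebra A] {μ : A → ℝ} {s : ℝ} (hs : 0 ≤ s)
    (hμ : μ ∈ measureBall A s) (B : BooleanSubalgebra A) :
    (fun b : B => μ b) ∈ measureBall B s := by
  rw [mem_measureBall_iff hs] at hμ ⊢
  refine ⟨fun a b h => hμ.1 a b ?_, fun P => ?_⟩
  · rw [disjoint_iff] at h ⊢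
    exact congrArg Subtype.val h
  · simpa [Finpartition.ofSubalgebra] using hμ.2 P.ofSubalgebra

/-! ### Finitely supported atomic measures -/

theorem Ult.not_disjoint {A : Type u} [BooleanAlgebra A] (x : Ult A) {a b : A}
    (ha : a ∈ x.carrier) (hb : b ∈ x.carrier) : ¬ Disjoint a b := fun h =>
  x.bot_notMem (h.eq_bot ▸ x.inf_mem a b ha hb)

theorem Ult.sup_mem_iff {A : Type u} [BooleanAlgebra A] (x : Ult A) {a b : A} :
    a ⊔ b ∈ x.carrier ↔ a ∈ x.carrier ∨ b ∈ x.carrier := by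
  refine ⟨fun h => ?_, ?_⟩
  · by_contra! hc
    have ha := (x.mem_or_compl_mem a).resolve_left hc.1
    have hb := (x.mem_or_compl_mem b).resolve_left hc.2
    refine x.not_disjoint h (x.inf_mem _ _ ha hb) ?_
    rw [← compl_sup]
    exact disjoint_compl_right
  · rintro (h | h)
    · exact x.mem_of_le _ _ h le_sup_left
    · exact x.mem_of_le _ _ h le_sup_right

/-- The Dirac measure of an ultrafilter. -/
noncomputable def dirac {A : Type u} [BooleanAlgebra A] (x : Ult A) (a : A) : ℝ :=
  open Classical in if a ∈ x.carrier then 1 else 0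

theorem dirac_mem_measureBall {A : Type u} [BooleanAlgebra A] (x : Ult A) :
    dirac x ∈ measureBall A 1 := by
  classical
  rw [mem_measureBall_iff zero_le_one]
  refine ⟨fun a b h => ?_, fun P => ?_⟩
  · have hab : a ∈ x.carrier → b ∉ x.carrier := fun ha hb => x.not_disjoint ha hb h
    by_cases ha : a ∈ x.carrier <;> by_cases hb : b ∈ x.carrier <;>
      simp_all [dirac, x.sup_mem_iff]
  · have : ∀ a, |dirac x a| = if a ∈ x.carrier then 1 else 0 := fun a => by
      unfold dirac; split_ifs <;> simp
    simp only [this, Finset.sum_boole]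
    norm_cast
    refine Finset.card_le_one.2 fun a ha b hb => ?_
    simp only [Finset.mem_filter] at ha hb
    by_contra hne
    exact x.not_disjoint ha.2 hb.2 (P.disjoint ha.1 hb.1 hne)

theorem zero_mem_measureBall (A : Type u) [BooleanAlgebra A] {s : ℝ} (hs : 0 ≤ s) :
    (fun _ => 0) ∈ measureBall A s := by
  rw [mem_measureBall_iff hs]
  exact ⟨fun _ _ _ => by simp, fun _ => by simpa using hs⟩

/-- The rational combination of Dirac measures given by a list of coefficients. -/
noncomputable def atomicMeasure {A : Type u} [BooleanAlgebra A] {ι : Type*} (x : ι → Ult A)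
    (c : List (ι × ℚ)) (a : A) : ℝ :=
  (c.map fun p => (p.2 : ℝ) * dirac (x p.1) a).sum

/-- The sum of the absolute values of the coefficients. -/
def coeffNorm {ι : Type*} (c : List (ι × ℚ)) : ℝ := (c.map fun p => |(p.2 : ℝ)|).sum

theorem coeffNorm_nonneg {ι : Type*} (c : List (ι × ℚ)) : 0 ≤ coeffNorm c :=
  List.sum_nonneg (by simp only [List.mem_map]; rintro _ ⟨p, -, rfl⟩; positivity)

theorem atomicMeasure_mem_measureBall {A : Type u} [BooleanAlgebra A] {ι : Type*} (x : ι → Ult A)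
    (c : List (ι × ℚ)) : atomicMeasure x c ∈ measureBall A (coeffNorm c) := by
  induction c with
  | nil => exact zero_mem_measureBall A (s := 0) le_rfl
  | cons p c ih =>
    have h : (fun a => (p.2 : ℝ) * dirac (x p.1) a) ∈ measureBall A |(p.2 : ℝ)| := by
      have hd := (mem_measureBall_iff zero_le_one).1 (dirac_mem_measureBall (x p.1))
      rw [mem_measureBall_iff (abs_nonneg _)]
      refine ⟨fun a b h => ?_, fun P => ?_⟩
      · simp only [hd.1 a b h]; ring
      · simp only [abs_mul, ← Finset.mul_sum]
        exact mul_le_of_le_one_right (abs_nonneg _) (hd.2 P)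
    have := measureBall_add (abs_nonneg _) (coeffNorm_nonneg c) h ih
    have e : atomicMeasure x (p :: c) =
        fun a => (p.2 : ℝ) * dirac (x p.1) a + atomicMeasure x c a := by
      funext a; simp [atomicMeasure]
    rw [e]
    simpa [coeffNorm] using this

theorem atomicMeasure_rational {A : Type u} [BooleanAlgebra A] {ι : Type*} (x : ι → Ult A)
    (c : List (ι × ℚ)) (a : A) : ∃ q : ℚ, atomicMeasure x c a = q := by
  induction c with
  | nil => exact ⟨0, by simp [atomicMeasure]⟩
  | cons p c ih =>
    obtain ⟨q, hq⟩ := ih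
    by_cases h : a ∈ (x p.1).carrier
    · exact ⟨p.2 + q, by simp [atomicMeasure, dirac, h] at hq ⊢; exact hq⟩
    · exact ⟨q, by simp [atomicMeasure, dirac, h] at hq ⊢; exact hq⟩

theorem atomicMeasure_restrict_mem {A : Type u} [BooleanAlgebra A] {ι : Type*} (x : ι → Ult A)
    {c : List (ι × ℚ)} {s : ℝ} (hc : coeffNorm c ≤ s) (B : BooleanSubalgebra A) :
    (fun b : B => atomicMeasure x c b) ∈ ratMeasureBall B s :=
  ⟨measureBall_mono hc (measureBall_restrict (coeffNorm_nonneg c)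
    (atomicMeasure_mem_measureBall x c) B), fun b => atomicMeasure_rational x c b⟩

/-- Prescribing rational values on the atoms of a finite subalgebra by an atomic measure on the
whole algebra, without increasing the norm. -/
theorem exists_atomicMeasure_of_atoms {A : Type u} [BooleanAlgebra A] {ι : Type*} {x : ι → Ult A}
    (hx : ∀ a : A, a ≠ ⊥ → ∃ i, a ∈ (x i).carrier) (B : BooleanSubalgebra A) [Finite B]
    (q : B → ℚ) :
    ∃ c : List (ι × ℚ), coeffNorm c = ∑ a ∈ atomFinset B, |(q a : ℝ)| ∧
      ∀ a ∈ atomFinset B, atomicMeasure x c a = q a := by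
  classical
  have hx' : ∀ a : atomFinset B, ∃ i, (a : A) ∈ (x i).carrier := fun a =>
    hx _ fun h => (mem_atomFinset.1 a.2).1 (Subtype.ext h)
  choose j hj using hx'
  -- One point mass inside each atom; disjointness keeps it from charging the other atoms.
  refine ⟨(atomFinset B).attach.toList.map fun a => (j a, q a), ?_, fun a ha => ?_⟩
  · simp only [coeffNorm, List.map_map, Function.comp_def, Finset.sum_map_toList]
    exact Finset.sum_attach (atomFinset B) fun a => |(q a : ℝ)|
  · simp only [atomicMeasure, List.map_map, Function.comp_def, Finset.sum_map_toList]
    rw [Finset.sum_eq_single ⟨a, ha⟩]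
    · have : (a : A) ∈ (x (j ⟨a, ha⟩)).carrier := hj ⟨a, ha⟩
      simp [dirac, this]
    · intro b _ hb
      have hd : Disjoint (b : B) a :=
        pairwiseDisjoint_atomFinset B b.2 ha fun h => hb (Subtype.ext h)
      have : (a : A) ∉ (x (j b)).carrier := fun h =>
        (x (j b)).not_disjoint (hj b) h
          (by rw [disjoint_iff] at hd ⊢; exact congrArg Subtype.val hd)
      simp [dirac, this]
    · simp

theorem exists_atomicMeasure_eq {A : Type u} [BooleanAlgebra A] {ι : Type*} {x : ι → Ult A}
    (hx : ∀ a : A, a ≠ ⊥ → ∃ i, a ∈ (x i).carrier) (B : BooleanSubalgebra A) [Finite B]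
    {ν : B → ℝ} (hν : IsFinAdditive ν) (hq : ∀ b, ∃ q : ℚ, ν b = q) :
    ∃ c : List (ι × ℚ), coeffNorm c = ∑ a ∈ atomFinset B, |ν a| ∧
      ∀ b : B, atomicMeasure x c b = ν b := by
  classical
  choose q hq using hq
  obtain ⟨c, hc, h⟩ := exists_atomicMeasure_of_atoms hx B q
  refine ⟨c, by simpa [hq] using hc, fun b => ?_⟩
  have hadd := (atomicMeasure_restrict_mem x (le_refl (coeffNorm c)) B).1.1
  rw [hν.eq_sum_atoms b]
  refine (hadd.eq_sum_atoms b).trans (Finset.sum_congr rfl fun a ha => ?_)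
  rw [h a ha, hq a]

/-- Rounding towards zero, so that rounding the values on atoms cannot increase the norm. -/
theorem exists_rat_abs_le_near (y : ℝ) {η : ℝ} (hη : 0 < η) :
    ∃ q : ℚ, |(q : ℝ)| ≤ |y| ∧ |(q : ℝ) - y| ≤ η := by
  rcases lt_trichotomy y 0 with h | h | h
  · obtain ⟨q, h1, h2⟩ := exists_rat_btwn (show y < min 0 (y + η) from lt_min h (by linarith))
    rw [lt_min_iff] at h2
    refine ⟨q, ?_, ?_⟩
    · rw [abs_of_neg h2.1, abs_of_neg h]; linarith
    · rw [abs_le]; constructor <;> linarith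
  · exact ⟨0, by simp, by simp [h, hη.le]⟩
  · obtain ⟨q, h1, h2⟩ := exists_rat_btwn (show max 0 (y - η) < y from max_lt h (by linarith))
    rw [max_lt_iff] at h1
    refine ⟨q, ?_, ?_⟩
    · rw [abs_of_pos h1.1, abs_of_pos h]; linarith
    · rw [abs_le]; constructor <;> linarith

/-- On a finite subalgebra a measure is approximated by rational measures of no larger norm. -/
theorem exists_ratMeasure_near {A : Type u} [BooleanAlgebra A] {ι : Type*} {x : ι → Ult A}
    (hx : ∀ a : A, a ≠ ⊥ → ∃ i, a ∈ (x i).carrier) (B : BooleanSubalgebra A) [Finite B]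
    {μ : A → ℝ} {s : ℝ} (hs : 0 ≤ s) (hμ : μ ∈ measureBall A s) {η : ℝ} (hη : 0 < η) :
    ∃ ν ∈ ratMeasureBall B s, ∀ b : B, |ν b - μ b| ≤ η := by
  classical
  -- An error of `η / N` per atom sums to at most `η`; the extra 1 keeps `N` positive when there are
  -- no atoms.
  set N : ℝ := (atomFinset B).card + 1 with hN
  have hNpos : 0 < N := by positivity
  choose q hq1 hq2 using fun b : B => exists_rat_abs_le_near (μ b) (div_pos hη hNpos)
  obtain ⟨c, hc, h⟩ := exists_atomicMeasure_of_atoms hx B q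
  have hμB := measureBall_restrict hs hμ B
  have hcs : coeffNorm c ≤ s := hc.le.trans
    ((Finset.sum_le_sum fun a _ => hq1 a).trans (measureBall_sum_atoms_le hs hμB))
  have hmem := atomicMeasure_restrict_mem x hcs B
  refine ⟨_, hmem, fun b => ?_⟩
  rw [hmem.1.1.eq_sum_atoms b, hμB.1.eq_sum_atoms b, ← Finset.sum_sub_distrib]
  refine (Finset.abs_sum_le_sum_abs _ _).trans ?_
  have : ∀ a ∈ atomFinset B, |((if a ≤ b then atomicMeasure x c a else 0) -
      if a ≤ b then μ a else 0)| ≤ η / N := by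
    intro a ha
    split_ifs
    · rw [h a ha]; exact hq2 a
    · simpa using (div_pos hη hNpos).le
  refine (Finset.sum_le_card_nsmul _ _ _ this).trans ?_
  rw [nsmul_eq_mul, mul_div_assoc', div_le_iff₀ hNpos, mul_comm]
  exact mul_le_mul_of_nonneg_left (by simp [hN]) hη.le

/-- Two rational measures on finite subalgebras that almost agree on the intersection can be
perturbed so as to agree there, keeping the norms at most one. -/
theorem exists_consistent_near {A : Type u} [BooleanAlgebra A] {ι : Type*} {x : ι → Ult A}
    (hx : ∀ a : A, a ≠ ⊥ → ∃ i, a ∈ (x i).carrier) {B₁ B₂ : BooleanSubalgebra A}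
    [Finite B₁] [Finite B₂] {ν₁ : B₁ → ℝ} {ν₂ : B₂ → ℝ} (h₁ : ν₁ ∈ ratMeasureBall B₁ 1)
    (h₂ : ν₂ ∈ ratMeasureBall B₂ 1) {η : ℚ} (hη : 0 ≤ η)
    (h : ∀ (a : A) (ha₁ : a ∈ B₁) (ha₂ : a ∈ B₂), |ν₁ ⟨a, ha₁⟩ - ν₂ ⟨a, ha₂⟩| ≤ η) :
    ∃ μ₁ ∈ ratMeasureBall B₁ 1, ∃ μ₂ ∈ ratMeasureBall B₂ 1, Consistent μ₁ μ₂ ∧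
      (∀ b, |μ₁ b - ν₁ b| ≤ 2 * Nat.card B₁ * η) ∧ ∀ b, |μ₂ b - ν₂ b| ≤ 2 * Nat.card B₁ * η := by
  classical
  have hfin : ((B₁ ⊓ B₂ : BooleanSubalgebra A) : Set A).Finite :=
    (Set.toFinite (B₁ : Set A)).subset fun a ha => ha.1
  have : Finite (B₁ ⊓ B₂ : BooleanSubalgebra A) := hfin.to_subtype
  -- The discrepancy is a rational measure on the intersection, so an atomic measure on all of `A`
  -- induces it; adding that to `ν₂` removes the disagreement.
  let d : (B₁ ⊓ B₂ : BooleanSubalgebra A) → ℝ := fun b => ν₁ ⟨b, b.2.1⟩ - ν₂ ⟨b, b.2.2⟩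
  have hd : IsFinAdditive d := by
    intro a b hab
    have hab' : Disjoint (a : A) b := by
      rw [disjoint_iff] at hab ⊢; exact congrArg Subtype.val hab
    have e₁ := h₁.1.1 ⟨a, a.2.1⟩ ⟨b, b.2.1⟩
      (disjoint_iff.2 (Subtype.ext (disjoint_iff.1 hab')))
    have e₂ := h₂.1.1 ⟨a, a.2.2⟩ ⟨b, b.2.2⟩
      (disjoint_iff.2 (Subtype.ext (disjoint_iff.1 hab')))
    have : d (a ⊔ b) = ν₁ (⟨a, a.2.1⟩ ⊔ ⟨b, b.2.1⟩) - ν₂ (⟨a, a.2.2⟩ ⊔ ⟨b, b.2.2⟩) := rfl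
    rw [this, e₁, e₂]
    simp only [d]; ring
  have hdq : ∀ b, ∃ q : ℚ, d b = q := by
    intro b
    obtain ⟨q₁, e₁⟩ := h₁.2 ⟨b, b.2.1⟩
    obtain ⟨q₂, e₂⟩ := h₂.2 ⟨b, b.2.2⟩
    exact ⟨q₁ - q₂, by simp [d, e₁, e₂]⟩
  obtain ⟨c, hc, hcd⟩ := exists_atomicMeasure_eq hx _ hd hdq
  -- Bounds the norm of the correction: at most `Nat.card B₁` atoms, each contributing at most `η`.
  set σ : ℚ := Nat.card B₁ * η with hσ
  have hσ0 : 0 ≤ σ := by positivity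
  have hσ0' : (0 : ℝ) ≤ σ := by exact_mod_cast hσ0
  have hcσ : coeffNorm c ≤ σ := by
    rw [hc]
    refine (Finset.sum_le_card_nsmul _ _ (η : ℝ) fun a _ => h a.1 a.2.1 a.2.2).trans ?_
    rw [nsmul_eq_mul, hσ]
    push_cast
    refine mul_le_mul_of_nonneg_right ?_ (by exact_mod_cast hη)
    have e : (atomFinset (B₁ ⊓ B₂ : BooleanSubalgebra A)).card ≤
        Nat.card (B₁ ⊓ B₂ : BooleanSubalgebra A) := by
      have := Fintype.ofFinite (B₁ ⊓ B₂ : BooleanSubalgebra A)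
      rw [Nat.card_eq_fintype_card]; exact Finset.card_le_univ _
    have e' : Nat.card (B₁ ⊓ B₂ : BooleanSubalgebra A) ≤ Nat.card B₁ :=
      Nat.card_le_card_of_injective
        (fun b => (⟨b, b.2.1⟩ : B₁)) fun a b hab => Subtype.ext (congrArg (fun z : B₁ => (z : A)) hab)
    exact_mod_cast e.trans e'
  -- The corrected measure has norm at most `1 + σ`. Scaling both measures by the same rational `t`
  -- restores norm 1 and preserves agreement; scaling and correction each cost at most `σ`.
  set t : ℚ := 1 / (1 + σ) with ht
  have ht0 : (0 : ℝ) ≤ t := by exact_mod_cast (by positivity : 0 ≤ t)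
  have htσ : (t : ℝ) * (1 + σ) = 1 := by
    rw [ht]; push_cast; field_simp
  have ht1 : 1 - (t : ℝ) ≤ σ := by nlinarith
  have ht1' : (t : ℝ) ≤ 1 := by nlinarith
  have hl := atomicMeasure_restrict_mem x hcσ B₂
  have e2 : 2 * (Nat.card B₁ : ℝ) * η = 2 * σ := by rw [hσ]; push_cast; ring
  rw [e2]
  refine ⟨fun b => t * ν₁ b, ⟨measureBall_mono (by linarith)
      (measureBall_smul zero_le_one ht0 h₁.1), fun b => ?_⟩,
    fun b => t * (ν₂ b + atomicMeasure x c b), ⟨measureBall_mono htσ.le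
      (measureBall_smul (by positivity) ht0 (measureBall_add zero_le_one hσ0' h₂.1 hl.1)),
      fun b => ?_⟩, fun a ha₁ ha₂ => ?_, fun b => ?_, fun b => ?_⟩
  · obtain ⟨q, hq⟩ := h₁.2 b
    exact ⟨t * q, by simp only [hq]; push_cast; rfl⟩
  · obtain ⟨q, hq⟩ := h₂.2 b
    obtain ⟨q', hq'⟩ := hl.2 b
    exact ⟨t * (q + q'), by simp only [hq] ; simp only [hq']; push_cast; rfl⟩
  · have := hcd ⟨a, ha₁, ha₂⟩
    simp only [d] at this
    simp only [this]; ring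
  · have := abs_le.1 (measureBall_abs_le zero_le_one h₁.1 b)
    rw [abs_le]; constructor <;> nlinarith
  · have e := abs_le.1 (measureBall_abs_le zero_le_one h₂.1 b)
    have e' := abs_le.1 (measureBall_abs_le hσ0' hl.1 b)
    rw [abs_le]; constructor <;> nlinarith

/-! ### Ultrafilters -/

/-- The complement of a prime ideal avoiding `a` is an ultrafilter containing `a`. -/
theorem exists_ult_mem {A : Type u} [BooleanAlgebra A] {a : A} (ha : a ≠ ⊥) :
    ∃ x : Ult A, a ∈ x.carrier := by
  obtain ⟨J, hJ, -, hdisj⟩ := DistribLattice.prime_ideal_of_disjoint_filter_ideal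
    (F := Order.PFilter.principal a) (I := Order.Ideal.principal (⊥ : A))
    (Set.disjoint_left.2 fun b hb hb' => ha (by
      simp at hb hb'
      have hb'' : b ≤ ⊥ := hb'
      exact le_bot_iff.1 (hb.trans hb'')))
  have hJt : (⊤ : A) ∉ J := fun h => hJ.1.ne_top (Order.Ideal.top_of_top_mem h)
  have hJp : ∀ b : A, b ∈ J → bᶜ ∉ J := fun b hb hc => hJt (by
    have := J.sup_mem hb hc
    rwa [sup_compl_eq_top] at this)
  have hJc : ∀ b : A, b ∈ J ∨ bᶜ ∈ J := fun b => hJ.mem_or_mem (by simp)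
  refine ⟨⟨{b | b ∉ J}, hJt, fun h => h J.bot_mem, fun b c hb hbc hc => hb (J.lower hbc hc),
    fun b c hb hc h => ?_, fun b => ?_⟩, fun h => Set.disjoint_left.1 hdisj (by simp) h⟩
  · rcases hJ.mem_or_mem h with h | h
    · exact hb h
    · exact hc h
  · by_cases hb : b ∈ J
    · exact Or.inr (hJp b hb)
    · exact Or.inl hb

theorem exists_countable_dense_ult {A : Type u} [BooleanAlgebra A]
    (hsep : TopologicalSpace.SeparableSpace (Ult A)) :
    ∃ S : Set (Ult A), S.Countable ∧ ∀ a : A, a ≠ ⊥ → ∃ i : S, a ∈ (i : Ult A).carrier := by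
  obtain ⟨S, hS, hd⟩ := TopologicalSpace.exists_countable_dense (Ult A)
  refine ⟨S, hS, fun a ha => ?_⟩
  obtain ⟨y, hy, hyS⟩ := hd.inter_open_nonempty {x : Ult A | a ∈ x.carrier}
    (TopologicalSpace.isOpen_generateFrom_of_mem ⟨a, rfl⟩) (exists_ult_mem ha)
  exact ⟨⟨y, hyS⟩, hy⟩

/-! ### Asymptotic measures on finite subalgebras -/

theorem distOn_bddAbove {A : Type u} [BooleanAlgebra A] (B : BooleanSubalgebra A) [Finite B]
    (μ ψ : A → ℝ) : BddAbove (Set.range fun b : B => |μ b - ψ b|) :=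
  (Set.finite_range _).bddAbove

theorem exists_distOn_lt {A : Type u} [BooleanAlgebra A] (B : BooleanSubalgebra A) [Finite B]
    (ψ : A → ℝ) {η : ℝ} (h : (⨅ μ : measureBall A 1, distOn B (μ : A → ℝ) ψ) < η) :
    ∃ μ ∈ measureBall A 1, ∀ b ∈ B, |μ b - ψ b| < η := by
  have : Nonempty (measureBall A 1) := ⟨⟨_, zero_mem_measureBall A zero_le_one⟩⟩
  obtain ⟨μ, hμ⟩ := exists_lt_of_ciInf_lt h
  exact ⟨μ, μ.2, fun b hb => (le_ciSup (distOn_bddAbove B μ ψ) ⟨b, hb⟩).trans_lt hμ⟩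

theorem AsympMeasure.eventually_exists_rat {A : Type u} [BooleanAlgebra A] {ι : Type*}
    {x : ι → Ult A} (hx : ∀ a : A, a ≠ ⊥ → ∃ i, a ∈ (x i).carrier) {φ : ℕ → A → ℝ}
    (hφ : AsympMeasure φ) {B : BooleanSubalgebra A} (hB : (B : Set A).Finite) {η : ℝ}
    (hη : 0 < η) :
    ∃ n, ∀ m ≥ n, ∃ ν ∈ ratMeasureBall B 1, ∀ b : B, |ν b - φ m b| ≤ η := by
  have : Finite B := hB.to_subtype
  obtain ⟨n, hn⟩ := eventually_atTop.1 ((hφ B hB).eventually_lt_const (half_pos hη))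
  refine ⟨n, fun m hm => ?_⟩
  obtain ⟨μ, hμ, hd⟩ := exists_distOn_lt B (φ m) (hn m hm)
  obtain ⟨ν, hν, hνd⟩ := exists_ratMeasure_near hx B zero_le_one hμ (half_pos hη)
  refine ⟨ν, hν, fun b => ?_⟩
  have := abs_sub_le (ν b) (μ b) (φ m b)
  linarith [hνd b, hd b b.2]

/-- The whole algebra is itself a finite subalgebra, so near-minimisers of the distance suffice.
This case is separate because `A × ℕ` has the cardinality of `A` only for infinite `A`. -/
theorem approximationProperty_of_finite (A : Type u) [BooleanAlgebra A] [Finite A] :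
    ApproximationProperty A := by
  intro φ _ hφ
  have hlim := hφ ⊤ (Set.toFinite _)
  have key : ∀ n : ℕ, ∃ μ ∈ measureBall A 1, ∀ b ∈ (⊤ : BooleanSubalgebra A),
      |μ b - φ n b| < (⨅ μ : measureBall A 1, distOn ⊤ (μ : A → ℝ) (φ n)) + 1 / ((n : ℝ) + 1) :=
    fun n => exists_distOn_lt ⊤ (φ n) (lt_add_of_pos_right _ (by positivity))
  choose ν hν hd using key
  refine ⟨ν, ⟨1, hν⟩, fun a => ?_⟩
  refine squeeze_zero_norm (fun n => ?_)
    (by simpa using hlim.add tendsto_one_div_add_atTop_nhds_zero_nat)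
  rw [Real.norm_eq_abs, abs_sub_comm, ← one_div]
  exact (hd n a BooleanSubalgebra.mem_top).le

/-! ### The partial order of finite approximations -/

/-- The precision demanded of the approximations on an algebra with `N` elements. -/
def tolerance (e N : ℕ) : ℚ := 1 / ((e + 1) * (4 * N + 1))

theorem tolerance_pos (e N : ℕ) : 0 < tolerance e N := by unfold tolerance; positivity

/-- The error budget of amalgamation: one tolerance for the promise, plus the perturbation cost `2 *
N * η` with `η` twice the tolerance, since two promised measures can differ by that much. -/
theorem tolerance_add (e N : ℕ) :
    (tolerance e N : ℝ) + 2 * N * (2 * tolerance e N) = 1 / ((e : ℝ) + 1) := by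
  unfold tolerance
  push_cast
  field_simp
  ring

theorem tolerance_le (e N : ℕ) : (tolerance e N : ℝ) ≤ 1 / ((e : ℝ) + 1) := by
  rw [← tolerance_add e N]
  have : (0 : ℝ) < tolerance e N := by exact_mod_cast tolerance_pos e N
  have : (0 : ℝ) ≤ 2 * N * (2 * tolerance e N) := by positivity
  linarith

/-- Finite initial segments of a sequence of atomic measures approximating `φ`, with a promise
concerning the approximation on a finite subalgebra. -/
@[ext]
structure Approximation {A : Type u} [BooleanAlgebra A] {ι : Type u} (x : ι → Ult A)
    (φ : ℕ → A → ℝ) (𝓑 : Set (BooleanSubalgebra A)) (r : ℝ) where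
  /-- The finite subalgebra on which `φ` is to be approximated. -/
  alg : BooleanSubalgebra A
  /-- The coefficients of the measures chosen so far. -/
  seq : List (List (ι × ℚ))
  /-- The precision is `1 / (prec + 1)`. -/
  prec : ℕ
  alg_mem : alg ∈ 𝓑
  seq_bound : ∀ c ∈ seq, coeffNorm c ≤ r
  approx : ∀ m ≥ seq.length, ∃ ν ∈ ratMeasureBall alg 1,
    ∀ b : alg, |ν b - φ m b| ≤ tolerance prec (Nat.card alg)

namespace Approximation

variable {A : Type u} [BooleanAlgebra A] {ι : Type u} {x : ι → Ult A} {φ : ℕ → A → ℝ}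
  {𝓑 : Set (BooleanSubalgebra A)} {r : ℝ}

/-- `l'` extends `l` by measures that approximate `φ` on `K` up to `1 / (e + 1)`. -/
def SeqLE (x : ι → Ult A) (φ : ℕ → A → ℝ) (K : Set A) (e : ℕ) (l l' : List (List (ι × ℚ))) :
    Prop :=
  l <+: l' ∧ ∀ i, l.length ≤ i → i < l'.length →
    ∀ b ∈ K, |atomicMeasure x (l'.getD i []) b - φ i b| ≤ 1 / ((e : ℝ) + 1)

theorem prefix_getD {α : Type*} {l l' : List α} (h : l <+: l') {i : ℕ} (hi : i < l.length)
    (d : α) : l'.getD i d = l.getD i d := by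
  obtain ⟨t, rfl⟩ := h
  exact List.getD_append _ _ _ _ hi

/-- Transitivity holds because entries appended after `q` are controlled on a larger algebra with
finer precision than `p` demands. -/
instance : PartialOrder (Approximation x φ 𝓑 r) where
  le p q := p.alg ≤ q.alg ∧ p.prec ≤ q.prec ∧ SeqLE x φ p.alg p.prec p.seq q.seq
  le_refl p := ⟨le_rfl, le_rfl, List.prefix_rfl, fun i h h' => absurd h' (by omega)⟩
  le_trans p q s hpq hqs := by
    refine ⟨hpq.1.trans hqs.1, hpq.2.1.trans hqs.2.1, hpq.2.2.1.trans hqs.2.2.1,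
      fun i h h' b hb => ?_⟩
    by_cases hi : i < q.seq.length
    · rw [prefix_getD hqs.2.2.1 hi]
      exact hpq.2.2.2 i h hi b hb
    · refine (hqs.2.2.2 i (by omega) h' b (hpq.1 hb)).trans ?_
      have : (p.prec : ℝ) ≤ q.prec := by exact_mod_cast hpq.2.1
      gcongr
  le_antisymm p q hpq hqp := by
    refine Approximation.ext (le_antisymm hpq.1 hqp.1) ?_ (le_antisymm hpq.2.1 hqp.2.1)
    exact hpq.2.2.1.eq_of_length_le hqp.2.2.1.length_le

theorem le_def {p q : Approximation x φ 𝓑 r} :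
    p ≤ q ↔ p.alg ≤ q.alg ∧ p.prec ≤ q.prec ∧ SeqLE x φ p.alg p.prec p.seq q.seq := Iff.rfl

/-- Different indices impose no condition on each other, so measures can be appended one at a time.
-/
theorem exists_seqLE {K : Set A} {e : ℕ} {l : List (List (ι × ℚ))}
    (hl : ∀ c ∈ l, coeffNorm c ≤ r)
    (H : ∀ m ≥ l.length, ∃ c : List (ι × ℚ), coeffNorm c ≤ r ∧
      ∀ b ∈ K, |atomicMeasure x c b - φ m b| ≤ 1 / ((e : ℝ) + 1)) (n : ℕ) :
    ∃ l', l'.length = l.length + n ∧ (∀ c ∈ l', coeffNorm c ≤ r) ∧ SeqLE x φ K e l l' := by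
  induction n with
  | zero => exact ⟨l, rfl, hl, List.prefix_rfl, fun i h h' => absurd h' (by omega)⟩
  | succ n ih =>
    obtain ⟨l', hlen, hb, hp, happ⟩ := ih
    obtain ⟨c, hc, hcK⟩ := H l'.length (by omega)
    refine ⟨l' ++ [c], by simp [hlen]; omega, ?_, hp.trans (List.prefix_append _ _), ?_⟩
    · intro c' hc'
      rcases List.mem_append.1 hc' with h | h
      · exact hb c' h
      · rw [List.mem_singleton.1 h]; exact hc
    · intro i h h' b hbK
      by_cases hi : i < l'.length
      · rw [prefix_getD (List.prefix_append _ _) hi]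
        exact happ i h hi b hbK
      · have : i = l'.length := by simp at h'; omega
        subst this
        simpa [List.getD_append_right] using hcK b hbK

/-- Every finite subalgebra, length and precision can be reached from a sequence for which single
further measures exist. -/
theorem exists_approximation (hx : ∀ a : A, a ≠ ⊥ → ∃ i, a ∈ (x i).carrier)
    (hφ : AsympMeasure φ) (h𝓑 : ∀ B ∈ 𝓑, (B : Set A).Finite)
    (hcov : ∀ C : BooleanSubalgebra A, (C : Set A).Finite → ∃ B ∈ 𝓑, C ≤ B)
    {K : Set A} {e : ℕ} {l : List (List (ι × ℚ))}
    (hl : ∀ c ∈ l, coeffNorm c ≤ r)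
    (H : ∀ m ≥ l.length, ∃ c : List (ι × ℚ), coeffNorm c ≤ r ∧
      ∀ b ∈ K, |atomicMeasure x c b - φ m b| ≤ 1 / ((e : ℝ) + 1))
    {C : BooleanSubalgebra A} (hC : (C : Set A).Finite) (j : ℕ) :
    ∃ s : Approximation x φ 𝓑 r, C ≤ s.alg ∧ j ≤ s.prec ∧ j ≤ s.seq.length ∧
      SeqLE x φ K e l s.seq := by
  obtain ⟨B, hB, hCB⟩ := hcov C hC
  obtain ⟨n, hn⟩ := hφ.eventually_exists_rat hx (h𝓑 B hB)
    (η := tolerance j (Nat.card B)) (by exact_mod_cast tolerance_pos _ _)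
  -- Appending `n` entries makes the promise on `B` valid; appending `j` secures the length.
  obtain ⟨l', hlen, hb, hle⟩ := exists_seqLE hl H (max n j)
  have h₁ := le_max_left n j
  have h₂ := le_max_right n j
  exact ⟨⟨B, l', j, hB, hb, fun m hm => hn m (by omega)⟩, hCB, le_rfl, by simp only; omega, hle⟩

theorem exists_next (hx : ∀ a : A, a ≠ ⊥ → ∃ i, a ∈ (x i).carrier)
    (h𝓑 : ∀ B ∈ 𝓑, (B : Set A).Finite) (hr : 1 ≤ r) (p : Approximation x φ 𝓑 r) (m : ℕ)
    (hm : p.seq.length ≤ m) : ∃ c : List (ι × ℚ), coeffNorm c ≤ r ∧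
      ∀ b ∈ p.alg, |atomicMeasure x c b - φ m b| ≤ 1 / ((p.prec : ℝ) + 1) := by
  have : Finite p.alg := (h𝓑 _ p.alg_mem).to_subtype
  obtain ⟨ν, hν, hd⟩ := p.approx m hm
  obtain ⟨c, hc, hcν⟩ := exists_atomicMeasure_eq hx p.alg hν.1.1 hν.2
  refine ⟨c, ?_, fun b hb => ?_⟩
  · rw [hc]; exact (measureBall_sum_atoms_le zero_le_one hν.1).trans hr
  · rw [hcν ⟨b, hb⟩]; exact (hd ⟨b, hb⟩).trans (tolerance_le _ _)

/-- The amalgamation step: conditions with the same sequence and precision, on algebras of the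
same size, that allow the extension of consistent measures. -/
theorem exists_next_pair (hx : ∀ a : A, a ≠ ⊥ → ∃ i, a ∈ (x i).carrier)
    (h𝓑 : ∀ B ∈ 𝓑, (B : Set A).Finite) (hr : 1 ≤ r) (p q : Approximation x φ 𝓑 r)
    (hseq : q.seq = p.seq) (hprec : q.prec = p.prec) (hcard : Nat.card q.alg = Nat.card p.alg)
    (hext : ∀ ν₁ ∈ ratMeasureBall p.alg 1, ∀ ν₂ ∈ ratMeasureBall q.alg 1, Consistent ν₁ ν₂ →
      ∃ ν ∈ ratMeasureBall (p.alg ⊔ q.alg : BooleanSubalgebra A) r,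
        Extends ν ν₁ ∧ Extends ν ν₂) (m : ℕ) (hm : p.seq.length ≤ m) :
    ∃ c : List (ι × ℚ), coeffNorm c ≤ r ∧
      ∀ b ∈ (p.alg ∪ q.alg : Set A),
        |atomicMeasure x c b - φ m b| ≤ 1 / ((p.prec : ℝ) + 1) := by
  have hfp := h𝓑 _ p.alg_mem
  have hfq := h𝓑 _ q.alg_mem
  have : Finite p.alg := hfp.to_subtype
  have : Finite q.alg := hfq.to_subtype
  have : Finite (p.alg ⊔ q.alg : BooleanSubalgebra A) :=
    (BooleanSubalgebra.finite_sup hfp hfq).to_subtype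
  obtain ⟨ν₁, hν₁, hd₁⟩ := p.approx m hm
  obtain ⟨ν₂, hν₂, hd₂⟩ := q.approx m (hseq ▸ hm)
  rw [hprec, hcard] at hd₂
  have htol := tolerance_add p.prec (Nat.card p.alg)
  set δ := tolerance p.prec (Nat.card p.alg) with hδ
  -- Both promised measures are within `δ` of `φ m`, hence within `2 * δ` of each other on the
  -- intersection.
  obtain ⟨μ₁, hμ₁, μ₂, hμ₂, hcons, he₁, he₂⟩ := exists_consistent_near hx hν₁ hν₂
    (η := 2 * δ) (by have := tolerance_pos p.prec (Nat.card p.alg); positivity)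
    (fun a h₁ h₂ => by
      have e₁ := abs_le.1 (hd₁ ⟨a, h₁⟩)
      have e₂ := abs_le.1 (hd₂ ⟨a, h₂⟩)
      push_cast
      simp only at e₁ e₂
      rw [abs_le]; constructor <;> linarith)
  push_cast at he₁ he₂
  obtain ⟨ν, hν, hx₁, hx₂⟩ := hext μ₁ hμ₁ μ₂ hμ₂ hcons
  obtain ⟨c, hc, hcν⟩ := exists_atomicMeasure_eq hx _ hν.1.1 hν.2
  refine ⟨c, ?_, ?_⟩
  · rw [hc]; exact measureBall_sum_atoms_le (by linarith) hν.1
  · rintro b (hb | hb)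
    · obtain ⟨hb', e⟩ := hx₁ b hb
      rw [hcν ⟨b, hb'⟩, e, ← htol]
      have := abs_sub_le (μ₁ ⟨b, hb⟩) (ν₁ ⟨b, hb⟩) (φ m b)
      linarith [hd₁ ⟨b, hb⟩, he₁ ⟨b, hb⟩]
    · obtain ⟨hb', e⟩ := hx₂ b hb
      rw [hcν ⟨b, hb'⟩, e, ← htol]
      have := abs_sub_le (μ₂ ⟨b, hb⟩) (ν₂ ⟨b, hb⟩) (φ m b)
      linarith [hd₂ ⟨b, hb⟩, he₂ ⟨b, hb⟩]

theorem ccc [Countable ι] (hx : ∀ a : A, a ≠ ⊥ → ∃ i, a ∈ (x i).carrier)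
    (hφ : AsympMeasure φ) (hr : 1 ≤ r) (h𝓑 : ∀ B ∈ 𝓑, (B : Set A).Finite)
    (hcov : ∀ C : BooleanSubalgebra A, (C : Set A).Finite → ∃ B ∈ 𝓑, C ≤ B)
    (hpair : ∀ 𝓑' : Set (BooleanSubalgebra A), 𝓑' ⊆ 𝓑 → ¬ 𝓑'.Countable →
      ∃ B₁ ∈ 𝓑', ∃ B₂ ∈ 𝓑', B₁ ≠ B₂ ∧
        ∀ ν₁ ∈ ratMeasureBall B₁ 1, ∀ ν₂ ∈ ratMeasureBall B₂ 1, Consistent ν₁ ν₂ →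
          ∃ ν ∈ ratMeasureBall (B₁ ⊔ B₂ : BooleanSubalgebra A) r,
            Extends ν ν₁ ∧ Extends ν ν₂) :
    CCC (Approximation x φ 𝓑 r) := by
  intro S hS
  -- Countability of `ι` leaves only countably many types, so some fibre in `S` is uncountable.
  let type : Approximation x φ 𝓑 r → List (List (ι × ℚ)) × ℕ × ℕ := fun p =>
    (p.seq, p.prec, Nat.card p.alg)
  obtain ⟨t, ht⟩ : ∃ t, ¬ (S ∩ type ⁻¹' {t}).Countable := by
    by_contra! h
    refine hS ((Set.countable_iUnion h).mono fun p hp => ?_)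
    exact Set.mem_iUnion.2 ⟨type p, hp, rfl⟩
  set T := S ∩ type ⁻¹' {t} with hT
  have htype : ∀ p ∈ T, ∀ q ∈ T, q.seq = p.seq ∧ q.prec = p.prec ∧
      Nat.card q.alg = Nat.card p.alg := by
    intro p hp q hq
    have e : type q = type p := hq.2.trans hp.2.symm
    simpa [type] using e
  -- Within a fibre the subalgebra determines the condition, so uncountably many subalgebras occur
  -- and LEP applies.
  have hinj : Set.InjOn Approximation.alg T := fun p hp q hq h =>
    Approximation.ext h (htype q hq p hp).1 (htype q hq p hp).2.1
  have hunc : ¬ (Approximation.alg '' T).Countable := fun h =>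
    ht (Set.countable_of_injective_of_countable_image hinj h)
  obtain ⟨_, ⟨p, hp, rfl⟩, _, ⟨q, hq, rfl⟩, hne, hext⟩ := hpair (Approximation.alg '' T)
    (by rintro _ ⟨p, -, rfl⟩; exact p.alg_mem) hunc
  obtain ⟨hseq, hprec, hcard⟩ := htype p hp q hq
  obtain ⟨s, hs, hsp, -, hsl⟩ := exists_approximation hx hφ h𝓑 hcov p.seq_bound
    (exists_next_pair hx h𝓑 hr p q hseq hprec hcard hext)
    (BooleanSubalgebra.finite_sup (h𝓑 _ p.alg_mem) (h𝓑 _ q.alg_mem)) p.prec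
  refine ⟨p, hp.1, q, hq.1, fun h => hne (h ▸ rfl), s, ?_, ?_⟩
  · exact le_def.2 ⟨le_sup_left.trans hs, hsp, hsl.1,
      fun i h h' b hb => hsl.2 i h h' b (Or.inl hb)⟩
  · refine le_def.2 ⟨le_sup_right.trans hs, hprec ▸ hsp, ?_⟩
    rw [hseq, hprec]
    exact ⟨hsl.1, fun i h h' b hb => hsl.2 i h h' b (Or.inr hb)⟩

theorem exists_ge (hx : ∀ a : A, a ≠ ⊥ → ∃ i, a ∈ (x i).carrier)
    (hφ : AsympMeasure φ) (hr : 1 ≤ r) (h𝓑 : ∀ B ∈ 𝓑, (B : Set A).Finite)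
    (hcov : ∀ C : BooleanSubalgebra A, (C : Set A).Finite → ∃ B ∈ 𝓑, C ≤ B)
    (a : A) (j : ℕ) (p : Approximation x φ 𝓑 r) :
    ∃ s : Approximation x φ 𝓑 r, (a ∈ s.alg ∧ j ≤ s.prec ∧ j ≤ s.seq.length) ∧ p ≤ s := by
  obtain ⟨s, hs, hsp, hsn, hsl⟩ := exists_approximation hx hφ h𝓑 hcov p.seq_bound
    (exists_next hx h𝓑 hr p)
    (BooleanSubalgebra.finite_sup (h𝓑 _ p.alg_mem)
      (BooleanSubalgebra.finite_closure (Set.finite_singleton a))) (max p.prec j)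
  have h₁ := le_max_left p.prec j
  have h₂ := le_max_right p.prec j
  exact ⟨s, ⟨hs ((le_sup_right : _ ≤ p.alg ⊔ BooleanSubalgebra.closure {a})
    (BooleanSubalgebra.subset_closure rfl)), h₂.trans hsp, h₂.trans hsn⟩,
    le_def.2 ⟨le_sup_left.trans hs, h₁.trans hsp, hsl⟩⟩

theorem nonempty (hx : ∀ a : A, a ≠ ⊥ → ∃ i, a ∈ (x i).carrier)
    (hφ : AsympMeasure φ) (hr : 1 ≤ r) (h𝓑 : ∀ B ∈ 𝓑, (B : Set A).Finite)
    (hcov : ∀ C : BooleanSubalgebra A, (C : Set A).Finite → ∃ B ∈ 𝓑, C ≤ B) :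
    Nonempty (Approximation x φ 𝓑 r) := by
  obtain ⟨s, -⟩ := exists_approximation (r := r) (K := ∅) (e := 0) (l := []) (C := ⊥)
    -- With `K = ∅` nothing has to be approximated, so the zero measure, coded by `[]`, may be
    -- appended.
    hx hφ h𝓑 hcov (by simp) (fun m _ => ⟨[], by simp [coeffNorm]; linarith, by simp⟩)
    (by simp) 0
  exact ⟨s⟩

/-- A sufficiently generic directed set of approximations yields a sequence of measures. -/
theorem exists_measures_of_directed {G : Set (Approximation x φ 𝓑 r)}
    (hG : DirectedOn (· ≤ ·) G)
    (hgen : ∀ (a : A) (j : ℕ), ∃ p ∈ G, a ∈ p.alg ∧ j ≤ p.prec ∧ j ≤ p.seq.length) :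
    ∃ ν : ℕ → A → ℝ, (∀ n, ν n ∈ measureBall A r) ∧
      ∀ a, Tendsto (fun n => φ n a - ν n a) atTop (𝓝 0) := by
  -- Length at least `i + 1` ensures that entry `i` exists, so the default of `getD` is never read;
  -- `⊥` is an arbitrary choice.
  choose! g hgG hgalg hgprec hglen using fun i : ℕ => hgen ⊥ (i + 1)
  refine ⟨fun i => atomicMeasure x ((g i).seq.getD i []), fun i => ?_, fun a => ?_⟩
  · refine measureBall_mono ?_ (atomicMeasure_mem_measureBall x _)
    have := hglen i
    rw [List.getD_eq_getElem _ _ (by omega)]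
    exact (g i).seq_bound _ (List.getElem_mem _)
  · rw [Metric.tendsto_atTop]
    intro ε hε
    obtain ⟨j, hj⟩ := exists_nat_one_div_lt hε
    obtain ⟨p, hpG, hpa, hpj, -⟩ := hgen a j
    refine ⟨p.seq.length, fun i hi => ?_⟩
    -- The list of `s` extends that of `g i`, so entry `i` is unchanged; lying above `p`, it meets
    -- the demand of `p` at `a`.
    obtain ⟨s, -, hps, hgs⟩ := hG p hpG (g i) (hgG i)
    have hlen := hglen i
    have hlt : i < (g i).seq.length := by omega
    have h := (le_def.1 hps).2.2.2 i hi
      (hlt.trans_le (le_def.1 hgs).2.2.1.length_le) a hpa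
    rw [prefix_getD (le_def.1 hgs).2.2.1 hlt] at h
    rw [Real.dist_eq, sub_zero, abs_sub_comm]
    refine (h.trans ?_).trans_lt hj
    have : (j : ℝ) ≤ p.prec := by exact_mod_cast hpj
    gcongr

end Approximation

theorem theorem4p7 (A : Type u) [BooleanAlgebra A] (κ : Cardinal.{u}) (hκ : #A = κ)
    (r : ℝ) (hr : 1 < r) (hLEP : LEP A r)
    (hsep : TopologicalSpace.SeparableSpace (Ult A)) (hMA : MartinAxiom κ) :
    ApproximationProperty A := by
  rcases finite_or_infinite A with hA | hA
  · exact approximationProperty_of_finite A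
  intro φ _ hφ
  obtain ⟨𝓑, h𝓑, hcov, hpair⟩ := hLEP
  obtain ⟨S, hS, hx⟩ := exists_countable_dense_ult hsep
  have : Countable S := hS.to_subtype
  let x : S → Ult A := Subtype.val
  have hne : Nonempty (Approximation x φ 𝓑 r) :=
    Approximation.nonempty hx hφ hr.le h𝓑 hcov
  -- One dense set for each element and each natural number: `κ` many, as `A` is infinite.
  obtain ⟨G, hG, hgen⟩ := hMA (Approximation x φ 𝓑 r)
    (Approximation.ccc hx hφ hr.le h𝓑 hcov hpair) (A × ULift.{u} ℕ)
    (by rw [mk_prod, lift_id, lift_id, mk_uLift, mk_nat, lift_aleph0,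
      mul_aleph0_eq (aleph0_le_mk A), hκ])
    (fun i => {p | i.1 ∈ p.alg ∧ i.2.down ≤ p.prec ∧ i.2.down ≤ p.seq.length})
    (fun i p => Approximation.exists_ge hx hφ hr.le h𝓑 hcov i.1 i.2.down p)
  obtain ⟨ν, hν, hlim⟩ := Approximation.exists_measures_of_directed hG
    fun a j => hgen (a, ⟨j⟩)
  exact ⟨ν, ⟨r, hν⟩, hlim⟩
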